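/- For $m\ge 0$ write $[m]=\{1,\dots,m\}$. A permutation $\sigma$ of $[2m]$ is a *D-permutation* if $i\le\sigma(i)$ for every odd $i$ and $\sigma(i)\le i$ for every even $i$; it is a *D-cycle* if moreover it consists of a single cycle containing all of $[2m]$. A *Dumont permutation* of $[2m]$ is a permutation $\sigma$ of $[2m]$ with $i\le\sigma(i)$ for every odd $i$ and $\sigma(i)<i$ for every even $i$; a *Dumont derangement* is a Dumont permutation without fixed points. The (signless) Genocchi number $g_n$ ($n\ge1$) is the number of Dumont permutations of $[2n-2]$, and the (signless) median Genocchi number $h_n$ ($n\ge0$) is the number of Dumont derangements of $[2n+2]$. **Theorem 4.1.** For all $n\ge1$: 1. the number of D-cycles on $[2n]$ is the Genocchi number $g_n$; 2. the number of D-permutations on $[2n]$ is the median Genocchi number $h_n$. -/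

import Mathlib

namespace DPerm

/-- The set `[m] = {1, …, m}`. -/
abbrev interval (m : ℕ) : Finset ℕ := Finset.Icc 1 m

/-- A permutation of a finite set of positive integers is a D-permutation if
`i ≤ σ i` for every odd `i` and `σ i ≤ i` for every even `i`. -/
def IsDPermutation {A : Finset ℕ} (σ : Equiv.Perm A) : Prop :=
  ∀ i : A, (Odd (i : ℕ) → (i : ℕ) ≤ σ i) ∧ (Even (i : ℕ) → (σ i : ℕ) ≤ i)

/-- The set of D-permutations on `A`. -/
def dPermutations (A : Finset ℕ) : Set (Equiv.Perm A) :=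
  {σ | IsDPermutation σ}

/-- The set of D-cycles on `A`: the D-permutations for which all of `A` is a single cycle. -/
def dCycles (A : Finset ℕ) : Set (Equiv.Perm A) :=
  {σ | IsDPermutation σ ∧ σ.IsCycleOn Set.univ}

/-- A Dumont permutation: `i ≤ σ i` for every odd `i` and `σ i < i` for every even `i`. -/
def IsDumontPermutation {A : Finset ℕ} (σ : Equiv.Perm A) : Prop :=
  ∀ i : A, (Odd (i : ℕ) → (i : ℕ) ≤ σ i) ∧ (Even (i : ℕ) → (σ i : ℕ) < i)

/-- A Dumont derangement: a Dumont permutation without fixed points. -/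
def IsDumontDerangement {A : Finset ℕ} (σ : Equiv.Perm A) : Prop :=
  IsDumontPermutation σ ∧ ∀ i : A, σ i ≠ i

/-- The signless Genocchi number `g_n` (for `n ≥ 1`; the value at `0` has no meaning):
the number of Dumont permutations on `[2n - 2]`. First values `1, 1, 3, 17, 155, …`. -/
noncomputable def genocchi (n : ℕ) : ℕ :=
  {σ : Equiv.Perm (interval (2 * n - 2)) | IsDumontPermutation σ}.ncard

/-- The signless median Genocchi number `h_n`: the number of Dumont derangements
on `[2n + 2]`. First values, from `n = 0` on: `1, 2, 8, 56, 608, …`. -/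
noncomputable def medianGenocchi (n : ℕ) : ℕ :=
  {σ : Equiv.Perm (interval (2 * n + 2)) | IsDumontDerangement σ}.ncard

end DPerm

/-!
Dumont permutations, D-cycles and D-permutations are compared by explicit bijections.

For the cycles, both sides are encoded by words. In a D-cycle on `[2n]` the point `2n - 1` must be
followed by `2n`, so the cycle reads `(2n - 1, 2n, w)` for a word `w` listing `[2n - 2]`. The
D-conditions around the cycle say exactly that in `w` every odd letter is followed by a larger
letter or stands last, while every even letter is followed by a smaller one
(`ncard_dumontWords_eq_cycles`). Foata's fundamental transformation then cuts such a word after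
each right-to-left minimum and closes every block into a cycle. The only new arrows lead from the
minimum of a block to a letter of that block; such a minimum is last or is followed by a larger
letter, hence is odd, and the new arrow is weakly increasing. So the result is a Dumont
permutation, and every Dumont permutation arises exactly once (`ncard_dumontWords`).

The transformation is built one letter at a time (`foata`): prepending `x` to `l` makes `x` a new
fixed point if it is smaller than all letters of `l`, and otherwise inserts it into the cycle of the
first letter of `l`, just before that letter. The inverse is also a recursion, since the first
letter of the word is the image of the least letter (`foata_apply_min`).

For the permutations, let `s` exchange `2k - 1` and `2k` on `[2n + 2]`. Then `τ` is a Dumont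
derangement iff `π = τ ∘ s` satisfies `i ≤ π i` for even `i` and `π i ≤ i` for odd `i`. Such a `π`
fixes `1` and `2n + 2`, and on the remaining interval it is a D-permutation of `[2n]` shifted by one
(`ncard_dPermutations`).
-/

namespace DPerm

open Equiv

/-! ### Foata's fundamental transformation -/

section Foata

variable {α : Type*} [LinearOrder α]

/-- Foata's fundamental transformation: for a word without repetitions, cut it after each
right-to-left minimum and close each block into a cycle, each letter being sent to the next one.
The word is read from the right: a letter `x` below all later ones is a block by itself, and any
other `x` is inserted before the first letter of the block that follows it. The default value of
`headD` is never used, because the empty tail falls under the first case. -/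
def foata : List α → Perm α
  | [] => 1
  | x :: t => if ∀ y ∈ t, x < y then foata t else swap x (t.headD x) * foata t

theorem foata_cons_of_lt {x : α} {t : List α} (h : ∀ y ∈ t, x < y) :
    foata (x :: t) = foata t := by
  rw [foata, if_pos h]

theorem foata_cons_cons_of_not_lt {x h : α} {t : List α} (hx : ¬ ∀ y ∈ h :: t, x < y) :
    foata (x :: h :: t) = swap x h * foata (h :: t) := by
  rw [foata, if_neg hx, List.headD_cons]

theorem foata_apply_of_notMem {l : List α} {i : α} (hi : i ∉ l) : foata l i = i := by
  induction l with
  | nil => rfl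
  | cons x t ih =>
    rw [List.mem_cons, not_or] at hi
    by_cases hx : ∀ y ∈ t, x < y
    · rw [foata_cons_of_lt hx, ih hi.2]
    · cases t with
      | nil => simp at hx
      | cons h s =>
        rw [foata_cons_cons_of_not_lt hx, Perm.mul_apply, ih hi.2]
        exact swap_apply_of_ne_of_ne hi.1 fun e => hi.2 (by simp [e])

/-- The least letter of a word is sent to the first letter: it closes the first block. This is what
makes the transformation invertible. -/
theorem foata_apply_min {x : α} {t : List α} (hl : (x :: t).Nodup) {m : α} (hm : m ∈ x :: t)
    (hmin : ∀ y ∈ x :: t, m ≤ y) : foata (x :: t) m = x := by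
  induction t generalizing x with
  | nil => simpa [foata] using hm
  | cons h s ih =>
    by_cases hx : ∀ y ∈ h :: s, x < y
    · have hmx : m = x := by
        rcases List.mem_cons.1 hm with e | e
        · exact e
        · exact absurd (hx m e) (not_lt.2 (hmin x (by simp)))
      rw [foata_cons_of_lt hx, hmx, foata_apply_of_notMem (List.nodup_cons.1 hl).1]
    · have hmx : m ≠ x := by
        rintro rfl
        refine hx fun y hy => lt_of_le_of_ne (hmin y (List.mem_cons_of_mem _ hy)) ?_
        rintro rfl
        exact (List.nodup_cons.1 hl).1 hy
      rw [foata_cons_cons_of_not_lt hx, Perm.mul_apply,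
        ih (List.nodup_cons.1 hl).2 ((List.mem_cons.1 hm).resolve_left hmx)
          fun y hy => hmin y (List.mem_cons_of_mem _ hy), swap_apply_right]

theorem foata_injective {l l' : List α} (hl : l.Nodup) (hl' : l'.Nodup)
    (hmem : ∀ i, i ∈ l ↔ i ∈ l') (h : foata l = foata l') : l = l' := by
  induction l generalizing l' with
  | nil =>
    exact (List.eq_nil_iff_forall_not_mem.2 fun i hi => by simpa using (hmem i).2 hi).symm
  | cons x t ih =>
    cases l' with
    | nil => simpa using hmem x
    | cons y s =>
      obtain ⟨m, hm, hmin⟩ : ∃ m ∈ x :: t, ∀ y ∈ x :: t, m ≤ y := by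
        obtain ⟨m, hm, hmin⟩ := (x :: t).toFinset.exists_min_image id ⟨x, by simp⟩
        exact ⟨m, by simpa using hm, fun y hy => hmin y (by simpa using hy)⟩
      obtain rfl : x = y := by
        rw [← foata_apply_min hl hm hmin, h,
          foata_apply_min hl' ((hmem m).1 hm) fun y hy => hmin y ((hmem y).2 hy)]
      rw [List.nodup_cons] at hl hl'
      have hmem' : ∀ i, i ∈ t ↔ i ∈ s := fun i => by
        have := hmem i
        simp only [List.mem_cons] at this
        by_cases hi : i = x
        · subst hi; simp [hl.1, hl'.1]
        · simpa [hi] using this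
      congr 1
      refine ih hl.2 hl'.2 hmem' ?_
      by_cases hx : ∀ y ∈ t, x < y
      · rwa [foata_cons_of_lt hx, foata_cons_of_lt fun y hy => hx y ((hmem' y).2 hy)] at h
      · have hx' : ¬ ∀ y ∈ s, x < y := fun hs => hx fun y hy => hs y ((hmem' y).1 hy)
        cases t with
        | nil => simp at hx
        | cons a t =>
          cases s with
          | nil => simp at hx'
          | cons b s =>
            rw [foata_cons_cons_of_not_lt hx, foata_cons_cons_of_not_lt hx'] at h
            have hab : a = b := by
              have := congrArg (fun σ : Perm α => σ x) h
              simpa [foata_apply_of_notMem hl.1, foata_apply_of_notMem hl'.1] using this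
            rw [hab] at h ⊢
            exact mul_left_cancel h

/-- The transformation is onto the permutations supported in `A`. The first letter of the word is
`x = σ m` with `m = min A`; deleting `x` from its cycle leaves a permutation supported in
`A \ {x}`. -/
theorem exists_foata_eq (A : Finset α) {σ : Perm α} (hσ : ∀ i ∉ A, σ i = i) :
    ∃ l : List α, l.Nodup ∧ l.toFinset = A ∧ foata l = σ := by
  induction A using Finset.strongInduction generalizing σ with
  | H A ih =>
    rcases A.eq_empty_or_nonempty with rfl | hA
    · exact ⟨[], by simp, by simp, by ext i; simp [foata, hσ i]⟩
    · have hmaps : ∀ i ∈ A, σ i ∈ A := fun i hi => by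
        by_contra h
        exact h (by rwa [σ.injective (hσ _ h)])
      obtain ⟨m, hm, hmin⟩ := A.exists_min_image id hA
      simp only [id] at hmin
      -- The first letter of the word is `σ m`; if it is `m` itself, then `m` is a block.
      by_cases hx : σ m = m
      · obtain ⟨t, ht, htA, rfl⟩ := ih (A.erase m) (Finset.erase_ssubset hm) (σ := σ) fun i hi => by
          by_cases him : i = m
          · rw [him, hx]
          · exact hσ i fun h => hi (Finset.mem_erase.2 ⟨him, h⟩)
        have hmem : ∀ i, i ∈ t ↔ i ≠ m ∧ i ∈ A := fun i => by
          rw [← List.mem_toFinset, htA, Finset.mem_erase]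
        refine ⟨m :: t, List.nodup_cons.2 ⟨by simp [hmem], ht⟩, ?_, foata_cons_of_lt fun y hy => ?_⟩
        · rw [List.toFinset_cons, htA, Finset.insert_erase hm]
        · exact lt_of_le_of_ne (hmin y ((hmem y).1 hy).2) ((hmem y).1 hy).1.symm
      · obtain ⟨x, hxm⟩ : ∃ x, σ m = x := ⟨_, rfl⟩
        have hxA : x ∈ A := hxm ▸ hmaps m hm
        obtain ⟨t, ht, htA, htσ⟩ := ih (A.erase x) (Finset.erase_ssubset hxA)
          (σ := swap x (σ x) * σ) fun i hi => by
            rw [Perm.mul_apply]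
            by_cases hix : i = x
            · rw [hix, swap_apply_right]
            · have hiA : i ∉ A := fun h => hi (Finset.mem_erase.2 ⟨hix, h⟩)
              rw [hσ i hiA]
              exact swap_apply_of_ne_of_ne hix fun h => hiA (h ▸ hmaps x hxA)
        have hmem : ∀ i, i ∈ t ↔ i ≠ x ∧ i ∈ A := fun i => by
          rw [← List.mem_toFinset, htA, Finset.mem_erase]
        have hmx : m ≠ x := fun h => hx (hxm.trans h.symm)
        have hmt : m ∈ t := (hmem m).2 ⟨hmx, hm⟩
        cases t with
        | nil => simp at hmt
        | cons h s =>
          have hh : h = σ x := by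
            rw [← foata_apply_min ht hmt fun y hy => hmin y ((hmem y).1 hy).2, htσ,
              Perm.mul_apply, hxm, swap_apply_left]
          refine ⟨x :: h :: s, List.nodup_cons.2 ⟨by simp [hmem], ht⟩, ?_, ?_⟩
          · rw [List.toFinset_cons, htA, Finset.insert_erase hxA]
          · rw [foata_cons_cons_of_not_lt fun hlt => absurd (hlt m hmt) (not_lt.2 (hmin x hxA)),
              htσ, hh, swap_mul_self_mul]

end Foata

/-! ### Dumont permutations as words -/

/-- The condition on `j = σ i` in the definition of a D-permutation, as a relation on `ℕ`. -/
def DStep (i j : ℕ) : Prop := (Odd i → i ≤ j) ∧ (Even i → j ≤ i)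

/-- The condition on `j = σ i` in the definition of a Dumont permutation, as a relation on `ℕ`. -/
def DumontStep (i j : ℕ) : Prop := (Odd i → i ≤ j) ∧ (Even i → j < i)

theorem dumontStep_iff_dStep {i j : ℕ} (h : i ≠ j) : DumontStep i j ↔ DStep i j := by
  simp only [DumontStep, DStep, lt_iff_le_and_ne, ne_eq, h.symm, not_false_eq_true, and_true]

theorem dumontStep_iff_odd {i j : ℕ} (h : i ≤ j) : DumontStep i j ↔ Odd i := by
  constructor
  · intro hs
    by_contra hi
    exact absurd (hs.2 (Nat.not_odd_iff_even.1 hi)) (not_lt.2 h)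
  · intro hi
    exact ⟨fun _ => h, fun he => absurd hi (Nat.not_odd_iff_even.2 he)⟩

/-- Prepending a letter changes the image of one old letter only, the least letter `m` of the old
word. The old and the new image of `m` are both at least `m`, so the Dumont condition at `m` says
in either case that `m` is odd. -/
theorem forall_dumontStep_foata_iff {l : List ℕ} (hl : l.Nodup) :
    (∀ i ∈ l, DumontStep i (foata l i)) ↔ l.IsChain DStep ∧ ∀ x ∈ l.getLast?, Odd x := by
  induction l with
  | nil => simp
  | cons x t ih =>
    have hxt := (List.nodup_cons.1 hl).1
    have ht := (List.nodup_cons.1 hl).2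
    cases t with
    | nil => simp [foata, dumontStep_iff_odd]
    | cons h s =>
      have hxh : x ≠ h := fun e => hxt (by simp [e])
      rw [List.isChain_cons_cons, List.getLast?_cons_cons, and_assoc, ← ih ht,
        ← dumontStep_iff_dStep hxh, List.forall_mem_cons]
      by_cases hx : ∀ y ∈ h :: s, x < y
      · rw [foata_cons_of_lt hx, foata_apply_of_notMem hxt, dumontStep_iff_odd le_rfl,
          dumontStep_iff_odd (hx h (by simp)).le]
      · rw [foata_cons_cons_of_not_lt hx, Perm.mul_apply, foata_apply_of_notMem hxt,
          swap_apply_left]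
        refine and_congr_right fun _ => forall₂_congr fun i hi => ?_
        obtain ⟨m, hm, hmin⟩ := (h :: s).toFinset.exists_min_image id ⟨h, by simp⟩
        replace hmin : ∀ y ∈ h :: s, m ≤ y := fun y hy => hmin y (by simpa using hy)
        replace hm : m ∈ h :: s := by simpa using hm
        have hmh := foata_apply_min ht hm hmin
        rw [Perm.mul_apply]
        by_cases him : i = m
          -- `m` was sent to `h` and is now sent to `x`; neither is below `m`.
        · have hmx : m ≤ x := by
            push Not at hx
            obtain ⟨y, hy, hyx⟩ := hx
            exact (hmin y hy).trans hyx
          rw [him, hmh, swap_apply_right, dumontStep_iff_odd hmx,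
            dumontStep_iff_odd (hmin h (by simp))]
        · rw [swap_apply_of_ne_of_ne]
          · intro e
            rw [← foata_apply_of_notMem hxt] at e
            exact hxt ((foata (h :: s)).injective e ▸ hi)
          · intro e
            exact him ((foata (h :: s)).injective (e.trans hmh.symm))

/-- The words listing `A` in which every odd letter is followed by a larger one or stands last, and
every even letter is followed by a smaller one. `DStep` is not strict, but consecutive letters of a
word without repetitions are distinct. -/
def dumontWords (A : Finset ℕ) : Set (List ℕ) :=
  {l | l.Nodup ∧ l.toFinset = A ∧ l.IsChain DStep ∧ ∀ x ∈ l.getLast?, Odd x}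

theorem ncard_dumontWords (A : Finset ℕ) :
    (dumontWords A).ncard =
      {σ : Perm ℕ | (∀ i ∉ A, σ i = i) ∧ ∀ i ∈ A, DumontStep i (σ i)}.ncard := by
  refine Set.BijOn.ncard_eq (f := foata) ⟨?_, ?_, ?_⟩
  · rintro l ⟨hl, rfl, hc⟩
    rw [← forall_dumontStep_foata_iff hl] at hc
    exact ⟨fun i hi => foata_apply_of_notMem (by simpa using hi), by simpa using hc⟩
  · rintro l ⟨hl, hA, -⟩ l' ⟨hl', hA', -⟩ h
    exact foata_injective hl hl'
      (fun i => by rw [← List.mem_toFinset, hA, ← hA', List.mem_toFinset]) h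
  · rintro σ ⟨hσ, hD⟩
    obtain ⟨l, hl, rfl, rfl⟩ := exists_foata_eq A hσ
    exact ⟨l, ⟨hl, rfl, (forall_dumontStep_foata_iff hl).1 (by simpa using hD)⟩, rfl⟩

/-! ### Cyclic permutations as words -/

section Cycles

variable {α : Type*} [DecidableEq α]

/-- A permutation that moves the elements of `A` in a single cycle is given by a word starting with
any chosen `z ∈ A`, namely `z, c z, c² z, …`. -/
theorem exists_formPerm_eq {A : Finset α} {c : Perm α} (hc : c.IsCycleOn (A : Set α))
    (hfix : ∀ i ∉ A, c i = i) {z : α} (hz : z ∈ A) :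
    ∃ w : List α, (z :: w).Nodup ∧ (z :: w).toFinset = A ∧ (z :: w).formPerm = c := by
  obtain ⟨k, hk⟩ : ∃ k, A.card = k + 1 :=
    Nat.exists_eq_succ_of_ne_zero (Finset.card_pos.2 ⟨z, hz⟩).ne'
  set l := (List.range (k + 1)).map fun j => (c ^ j) z with hl
  have hlen : l.length = k + 1 := by simp [hl]
  have hnd : l.Nodup := by
    refine List.Nodup.map_on (fun i hi j hj hij => ?_) List.nodup_range
    have := (hc.pow_apply_eq_pow_apply hz).1 hij
    rw [List.mem_range] at hi hj
    rw [hk] at this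
    exact Nat.ModEq.eq_of_lt_of_lt this hi hj
  have hA : l.toFinset = A := by
    ext i
    simp only [hl, List.mem_toFinset, List.mem_map, List.mem_range]
    constructor
    · rintro ⟨j, -, rfl⟩
      exact (hc.1.perm_pow j).mapsTo hz
    · intro hi
      obtain ⟨j, hj, rfl⟩ := hc.exists_pow_eq hz hi
      exact ⟨j, hk ▸ hj, rfl⟩
  have hform : l.formPerm = c := by
    ext i
    by_cases hi : i ∈ l
    · obtain ⟨j, hj, rfl⟩ := List.getElem_of_mem hi
      rw [List.formPerm_apply_getElem _ hnd]
      simp only [hl, List.getElem_map, List.getElem_range, ← Perm.mul_apply, ← pow_succ']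
      rw [hc.pow_apply_eq_pow_apply hz, hk, ← hl, hlen]
      exact Nat.mod_modEq _ _
    · rw [List.formPerm_apply_of_notMem hi, hfix i (by rwa [← hA, List.mem_toFinset])]
  have hcons : l = z :: l.tail := by
    simp [hl, List.range_succ_eq_map]
  rw [hcons] at hnd hA hform
  exact ⟨_, hnd, hA, hform⟩

theorem formPerm_cons_injective {z : α} {w w' : List α} (h : (z :: w).Nodup)
    (h' : (z :: w').Nodup) (hmem : (z :: w).toFinset = (z :: w').toFinset)
    (he : (z :: w).formPerm = (z :: w').formPerm) : w = w' := by
  have hlen : (z :: w).length = (z :: w').length := by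
    rw [← List.toFinset_card_of_nodup h, hmem, List.toFinset_card_of_nodup h']
  refine (List.cons.inj (List.ext_getElem hlen fun n h₁ h₂ => ?_)).2
  have := List.formPerm_pow_apply_head z w h n
  rw [he, List.formPerm_pow_apply_head z w' h' n] at this
  simpa only [Nat.mod_eq_of_lt h₁, Nat.mod_eq_of_lt h₂] using this.symm

/-- A relation holds along all arrows of a cycle iff it holds along the word that starts at `z`,
runs through the cycle and returns to `z`. -/
theorem forall_formPerm_iff_isChain {R : α → α → Prop} {z : α} {w : List α}
    (h : (z :: w).Nodup) :
    (∀ i ∈ z :: w, R i ((z :: w).formPerm i)) ↔ (z :: w ++ [z]).IsChain R := by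
  rw [List.isChain_iff_getElem, List.forall_mem_iff_getElem]
  have hlen : (z :: w ++ [z]).length = (z :: w).length + 1 := by simp
  refine forall_congr' fun n => ?_
  have key : ∀ hn : n < (z :: w).length, (z :: w).formPerm (z :: w)[n] =
      (z :: w ++ [z])[n + 1]'(by omega) := fun hn => by
    rw [List.formPerm_apply_getElem _ h]
    rcases Nat.lt_or_ge (n + 1) (z :: w).length with hlt | hge
    · simp only [Nat.mod_eq_of_lt hlt]
      rw [List.getElem_append_left hlt]
    · have hn1 : n + 1 = (z :: w).length := by omega
      rw [List.getElem_append_right hge]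
      simp only [hn1, Nat.mod_self]
      simp
  constructor
  · intro H hn
    have hn' : n < (z :: w).length := by omega
    rw [← key hn', List.getElem_append_left hn']
    exact H hn'
  · intro H hn
    have := H (by omega)
    rwa [← key hn, List.getElem_append_left hn] at this

end Cycles

/-- The steps from `2n + 1` to `2n + 2` and from `2n + 2` to anything are free. The final step into
`2n + 1` goes up, so it requires the last letter of `l` to be odd. For empty `l` it starts at
`2n + 2` and is free. -/
theorem isChain_dStep_cycle_iff {n : ℕ} {l : List ℕ} (hl : ∀ i ∈ l, i < 2 * n + 1) :
    ((2 * n + 1) :: (2 * n + 2) :: l ++ [2 * n + 1]).IsChain DStep ↔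
      l.IsChain DStep ∧ ∀ x ∈ l.getLast?, Odd x := by
  have hodd : Odd (2 * n + 1) := odd_two_mul_add_one n
  have heven : Even (2 * n + 2) := ⟨n + 1, by ring⟩
  have h₁ : DStep (2 * n + 1) (2 * n + 2) :=
    ⟨fun _ => by omega, fun h => absurd hodd (Nat.not_odd_iff_even.2 h)⟩
  have h₂ : ∀ j < 2 * n + 2, DStep (2 * n + 2) j := fun j hj =>
    ⟨fun h => absurd h (Nat.not_odd_iff_even.2 heven), fun _ => hj.le⟩
  have h₃ : (l ++ [2 * n + 1]).IsChain DStep ↔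
      l.IsChain DStep ∧ ∀ x ∈ l.getLast?, Odd x := by
    rw [List.isChain_append]
    simp only [List.isChain_singleton, List.head?_cons, Option.mem_some_iff, forall_eq', true_and]
    refine and_congr_right fun _ => forall₂_congr fun x hx => ?_
    have hxn := hl x (List.mem_of_getLast? hx)
    rw [← dumontStep_iff_dStep hxn.ne, dumontStep_iff_odd hxn.le]
  rw [← h₃, List.cons_append, List.cons_append, List.isChain_cons_cons, List.isChain_cons]
  refine ⟨fun h => h.2.2, fun h => ⟨h₁, fun y hy => h₂ y ?_, h⟩⟩
  have := List.mem_of_mem_head? hy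
  simp only [List.mem_append, List.mem_singleton] at this
  rcases this with h | rfl
  · have := hl y h
    omega
  · omega

theorem ncard_dumontWords_eq_cycles (n : ℕ) :
    (dumontWords (interval (2 * n))).ncard =
      {c : Perm ℕ | (∀ i ∉ interval (2 * n + 2), c i = i) ∧
        (∀ i ∈ interval (2 * n + 2), DStep i (c i)) ∧
        c.IsCycleOn (interval (2 * n + 2) : Set ℕ)}.ncard := by
  have hmem : ∀ {l : List ℕ}, l.toFinset = interval (2 * n) → ∀ i, i ∈ l ↔ 1 ≤ i ∧ i ≤ 2 * n :=
    fun h i => by rw [← List.mem_toFinset, h, Finset.mem_Icc]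
  have hset : ∀ {l : List ℕ}, l.toFinset = interval (2 * n) →
      ((2 * n + 1) :: (2 * n + 2) :: l).toFinset = interval (2 * n + 2) := fun h => by
    ext i
    simp only [List.toFinset_cons, h, Finset.mem_insert, Finset.mem_Icc]
    omega
  have hnd : ∀ {l : List ℕ}, l.Nodup → l.toFinset = interval (2 * n) →
      ((2 * n + 1) :: (2 * n + 2) :: l).Nodup := fun h h' => by
    simp [h, hmem h']
  refine Set.BijOn.ncard_eq (f := fun l => ((2 * n + 1) :: (2 * n + 2) :: l).formPerm) ⟨?_, ?_, ?_⟩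
  · rintro l ⟨hl, hA, hc⟩
    have hA' := hset hA
    have hl' := hnd hl hA
    refine ⟨fun i hi => List.formPerm_apply_of_notMem ?_, fun i hi => ?_, ?_⟩
    · rwa [← List.mem_toFinset, hA']
    · refine (forall_formPerm_iff_isChain hl').2 ((isChain_dStep_cycle_iff ?_).2 hc) i ?_
      · exact fun i hi => by have := (hmem hA i).1 hi; omega
      · rwa [← List.mem_toFinset, hA']
    · have := hl'.isCycleOn_formPerm
      rwa [← List.coe_toFinset, hA'] at this
  · rintro l ⟨hl, hA, -⟩ l' ⟨hl', hA', -⟩ h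
    exact (List.cons.inj (formPerm_cons_injective (hnd hl hA) (hnd hl' hA')
      ((hset hA).trans (hset hA').symm) h)).2
  · rintro c ⟨hfix, hD, hc⟩
    obtain ⟨w, hw, hwA, rfl⟩ := exists_formPerm_eq hc hfix (z := 2 * n + 1)
      (Finset.mem_Icc.2 ⟨by omega, by omega⟩)
    have hwmem : ∀ i, i ∈ (2 * n + 1) :: w ↔ 1 ≤ i ∧ i ≤ 2 * n + 2 :=
      fun i => by rw [← List.mem_toFinset, hwA, Finset.mem_Icc]
    have hchain := (forall_formPerm_iff_isChain (R := DStep) hw).1 fun i hi =>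
      hD i (Finset.mem_Icc.2 ((hwmem i).1 hi))
    cases w with
    | nil =>
      have := (hwmem (2 * n + 2)).2 ⟨by omega, le_rfl⟩
      simp at this
    | cons h l =>
      -- `2n + 1` is odd and not fixed, so it can only go to `2n + 2`.
      obtain rfl : h = 2 * n + 2 := by
        rw [List.cons_append, List.cons_append, List.isChain_cons_cons] at hchain
        have h₁ := hchain.1.1 (odd_two_mul_add_one n)
        have h₂ := (hwmem h).1 (by simp)
        have h₃ : 2 * n + 1 ≠ h := fun e => (List.nodup_cons.1 hw).1 (by simp [e])
        omega
      have hlA : l.toFinset = interval (2 * n) := by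
        ext i
        have hi := hwmem i
        simp only [List.nodup_cons, List.mem_cons, not_or] at hw hi
        rw [List.mem_toFinset, Finset.mem_Icc]
        constructor
        · intro h
          have h₁ : i ≠ 2 * n + 1 := fun e => hw.1.2 (e ▸ h)
          have h₂ : i ≠ 2 * n + 2 := fun e => hw.2.1 (e ▸ h)
          have := hi.1 (Or.inr (Or.inr h))
          omega
        · intro h
          rcases hi.2 ⟨h.1, by omega⟩ with h | h | h
          · omega
          · omega
          · exact h
      refine ⟨l, ⟨(hw.of_cons).of_cons, hlA, (isChain_dStep_cycle_iff fun i hi => ?_).1 hchain⟩,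
        rfl⟩
      have := (hmem hlA i).1 hi
      omega

/-! ### Counting D-cycles -/

/-- Permutations of `A` are counted as permutations of `ℕ` fixing everything outside `A`. -/
theorem ncard_setOf_ofSubtype (A : Finset ℕ) (Q : Perm ℕ → Prop) :
    {σ : Perm A | Q (Perm.ofSubtype σ)}.ncard =
      {τ : Perm ℕ | (∀ i ∉ A, τ i = i) ∧ Q τ}.ncard := by
  refine Set.BijOn.ncard_eq (f := Perm.ofSubtype) ⟨?_, ?_, ?_⟩
  · exact fun σ hσ => ⟨fun i hi => Perm.ofSubtype_apply_of_not_mem σ hi, hσ⟩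
  · exact Perm.ofSubtype_injective.injOn
  · rintro τ ⟨hτ, hQ⟩
    have h := ((Perm.subtypeEquivSubtypePerm (· ∈ A)).apply_symm_apply ⟨τ, hτ⟩)
    have h' := congrArg Subtype.val h
    refine ⟨_, ?_, h'⟩
    exact (congrArg Q h').mpr hQ

theorem isCycleOn_ofSubtype_iff {A : Finset ℕ} (σ : Perm A) :
    (Perm.ofSubtype σ).IsCycleOn (A : Set ℕ) ↔ σ.IsCycleOn Set.univ := by
  have hpow : ∀ (k : ℤ) (x : A), (Perm.ofSubtype σ ^ k) (x : ℕ) = (σ ^ k) x := fun k x => by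
    rw [← map_zpow, Perm.ofSubtype_apply_coe]
  constructor
  · refine fun h => ⟨Set.bijOn_univ.2 σ.bijective, fun x _ y _ => ?_⟩
    obtain ⟨k, hk⟩ := h.2 x.2 y.2
    exact ⟨k, Subtype.ext (by rw [← hpow, hk])⟩
  · refine fun h => ⟨?_, fun x hx y hy => ?_⟩
    · exact (Perm.ofSubtype σ).bijOn fun x => Perm.ofSubtype_apply_mem_iff_mem σ x
    · obtain ⟨k, hk⟩ := h.2 (Set.mem_univ (⟨x, hx⟩ : A)) (Set.mem_univ ⟨y, hy⟩)
      exact ⟨k, (hpow k ⟨x, hx⟩).trans (congrArg Subtype.val hk)⟩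

theorem forall_ofSubtype_iff {A : Finset ℕ} (R : ℕ → ℕ → Prop) (σ : Perm A) :
    (∀ i ∈ A, R i (Perm.ofSubtype σ i)) ↔ ∀ i : A, R i (σ i) := by
  simp only [Subtype.forall, ← Perm.ofSubtype_apply_coe]

theorem ncard_dCycles (n : ℕ) (hn : 1 ≤ n) : (dCycles (interval (2 * n))).ncard = genocchi n := by
  obtain ⟨k, rfl⟩ := Nat.exists_eq_add_of_le' hn
  have h₁ : dCycles (interval (2 * (k + 1))) =
      {σ | (∀ i ∈ interval (2 * k + 2), DStep i (Perm.ofSubtype σ i)) ∧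
        (Perm.ofSubtype σ).IsCycleOn (interval (2 * k + 2) : Set ℕ)} :=
    Set.ext fun σ =>
      and_congr (forall_ofSubtype_iff DStep σ).symm (isCycleOn_ofSubtype_iff σ).symm
  have h₂ : {σ : Perm (interval (2 * k)) | IsDumontPermutation σ} =
      {σ | ∀ i ∈ interval (2 * k), DumontStep i (Perm.ofSubtype σ i)} :=
    Set.ext fun σ => (forall_ofSubtype_iff DumontStep σ).symm
  -- `2 * (k + 1)` is `2 * k + 2` and `2 * (k + 1) - 2` is `2 * k`, both by definition.
  calc _ = _ := congrArg Set.ncard h₁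
    _ = _ := ncard_setOf_ofSubtype (interval (2 * k + 2)) fun c =>
        (∀ i ∈ interval (2 * k + 2), DStep i (c i)) ∧
          c.IsCycleOn (interval (2 * k + 2) : Set ℕ)
    _ = _ := (ncard_dumontWords_eq_cycles k).symm
    _ = _ := ncard_dumontWords _
    _ = _ := (ncard_setOf_ofSubtype (interval (2 * k)) fun σ =>
        ∀ i ∈ interval (2 * k), DumontStep i (σ i)).symm
    _ = _ := congrArg Set.ncard h₂.symm

/-! ### Counting D-permutations -/

/-- The involution of `[2n + 2]` exchanging `2k - 1` and `2k` for every `k`. -/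
def pairSwap (n : ℕ) : Perm (interval (2 * n + 2)) :=
  Function.Involutive.toPerm
    (fun i => ⟨if Odd (i : ℕ) then i + 1 else i - 1, by
      have hi := Finset.mem_Icc.1 i.2
      rw [Finset.mem_Icc]
      split_ifs with h
      · obtain ⟨k, hk⟩ := h
        omega
      · obtain ⟨k, hk⟩ := Nat.not_odd_iff_even.1 h
        omega⟩)
    (fun i => by
      have hi := Finset.mem_Icc.1 i.2
      refine Subtype.ext ?_
      simp only [Nat.odd_iff]
      split_ifs <;> omega)

theorem coe_pairSwap_apply {n : ℕ} (i : interval (2 * n + 2)) :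
    (pairSwap n i : ℕ) = if Odd (i : ℕ) then (i : ℕ) + 1 else i - 1 := rfl

theorem pairSwap_pairSwap {n : ℕ} (i : interval (2 * n + 2)) : pairSwap n (pairSwap n i) = i :=
  (pairSwap n).symm_apply_apply i

/-- The shift `i ↦ i + 1` from `[2n]` onto `{2, …, 2n + 1}`, the latter seen inside `[2n + 2]`. -/
def shift (n : ℕ) : interval (2 * n) ≃
    {x : interval (2 * n + 2) // 2 ≤ (x : ℕ) ∧ (x : ℕ) ≤ 2 * n + 1} where
  toFun i := ⟨⟨i + 1, by have := Finset.mem_Icc.1 i.2; rw [Finset.mem_Icc]; omega⟩, by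
    have := Finset.mem_Icc.1 i.2; simp only; omega⟩
  invFun x := ⟨x - 1, by have := x.2; rw [Finset.mem_Icc]; omega⟩
  left_inv i := by simp
  right_inv x := by
    have := x.2
    refine Subtype.ext (Subtype.ext ?_)
    simp only
    omega

theorem coe_shift_apply {n : ℕ} (i : interval (2 * n)) :
    (((shift n i : {x : interval (2 * n + 2) // 2 ≤ (x : ℕ) ∧ (x : ℕ) ≤ 2 * n + 1}) :
      interval (2 * n + 2)) : ℕ) = i + 1 := rfl

theorem isDumontDerangement_mul_pairSwap_iff {n : ℕ} (π : Perm (interval (2 * n + 2))) :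
    IsDumontDerangement (π * pairSwap n) ↔
      ∀ i : interval (2 * n + 2), (Even (i : ℕ) → (i : ℕ) ≤ π i) ∧
        (Odd (i : ℕ) → (π i : ℕ) ≤ i) := by
  have h₁ : IsDumontDerangement (π * pairSwap n) ↔
      ∀ i : interval (2 * n + 2), (Odd (i : ℕ) → (i : ℕ) < π (pairSwap n i)) ∧
        (Even (i : ℕ) → (π (pairSwap n i) : ℕ) < i) := by
    rw [IsDumontDerangement, IsDumontPermutation, ← forall_and]
    refine forall_congr' fun i => ?_
    rw [Perm.mul_apply, ne_eq, ← Subtype.coe_inj, Nat.odd_iff, Nat.even_iff]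
    omega
  rw [h₁, (pairSwap n).forall_congr_left]
  refine forall_congr' fun i => ?_
  have hs : (pairSwap n).symm i = pairSwap n i := rfl
  have hi := Finset.mem_Icc.1 i.2
  rw [hs, pairSwap_pairSwap, coe_pairSwap_apply]
  simp only [Nat.odd_iff, Nat.even_iff]
  split_ifs <;> omega

theorem isDPermutation_iff_extendDomain {n : ℕ} (σ : Perm (interval (2 * n))) :
    IsDPermutation σ ↔ ∀ i : interval (2 * n + 2),
      (Even (i : ℕ) → (i : ℕ) ≤ σ.extendDomain (shift n) i) ∧
      (Odd (i : ℕ) → (σ.extendDomain (shift n) i : ℕ) ≤ i) := by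
  constructor
  · intro h i
    by_cases hi : 2 ≤ (i : ℕ) ∧ (i : ℕ) ≤ 2 * n + 1
    · obtain ⟨j, hj⟩ := (shift n).surjective ⟨i, hi⟩
      have hij : i = shift n j := by rw [hj]
      have := h j
      rw [hij, Perm.extendDomain_apply_image, coe_shift_apply, coe_shift_apply]
      rw [Nat.odd_iff, Nat.even_iff] at this ⊢
      omega
    · rw [Perm.extendDomain_apply_not_subtype _ (shift n) hi]
      exact ⟨fun _ => le_rfl, fun _ => le_rfl⟩
  · intro h j
    have := h (shift n j)
    rw [Perm.extendDomain_apply_image, coe_shift_apply, coe_shift_apply] at this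
    rw [Nat.odd_iff, Nat.even_iff] at this ⊢
    omega

/-- The conditions force `π` to fix the end points `1` and `2n + 2`. -/
theorem exists_extendDomain_shift_eq {n : ℕ} {π : Perm (interval (2 * n + 2))}
    (h : ∀ i : interval (2 * n + 2),
      (Even (i : ℕ) → (i : ℕ) ≤ π i) ∧ (Odd (i : ℕ) → (π i : ℕ) ≤ i)) :
    ∃ σ : Perm (interval (2 * n)), σ.extendDomain (shift n) = π := by
  have hfix : ∀ i : interval (2 * n + 2), ¬ (2 ≤ (i : ℕ) ∧ (i : ℕ) ≤ 2 * n + 1) → π i = i := by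
    intro i hi
    have h₁ := Finset.mem_Icc.1 i.2
    have h₂ := Finset.mem_Icc.1 (π i).2
    have h₃ := h i
    rw [Nat.odd_iff, Nat.even_iff] at h₃
    refine Subtype.ext ?_
    omega
  let p : interval (2 * n + 2) → Prop := fun i => 2 ≤ (i : ℕ) ∧ (i : ℕ) ≤ 2 * n + 1
  have hπ : ((Perm.subtypeEquivSubtypePerm p)
      ((Perm.subtypeEquivSubtypePerm p).symm ⟨π, hfix⟩)).1 = π := by
    rw [Equiv.apply_symm_apply]
  refine ⟨(shift n).permCongr.symm ((Perm.subtypeEquivSubtypePerm p).symm ⟨π, hfix⟩),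
    Eq.trans (Equiv.ext fun i => ?_) hπ⟩
  by_cases hi : p i
  · rw [Perm.extendDomain_apply_subtype _ (shift n) hi,
      Perm.subtypeEquivSubtypePerm_apply_of_mem _ hi]
    simp
  · rw [Perm.extendDomain_apply_not_subtype _ (shift n) hi, hπ, hfix i hi]

theorem ncard_dPermutations (n : ℕ) :
    (dPermutations (interval (2 * n))).ncard = medianGenocchi n := by
  refine Set.BijOn.ncard_eq (f := fun σ => σ.extendDomain (shift n) * pairSwap n) ⟨?_, ?_, ?_⟩
  · exact fun σ hσ => (isDumontDerangement_mul_pairSwap_iff _).2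
      ((isDPermutation_iff_extendDomain σ).1 hσ)
  · exact fun σ _ τ _ h => Perm.extendDomainHom_injective (shift n) (mul_right_cancel h)
  · intro τ hτ
    have hτ' : IsDumontDerangement (τ * (pairSwap n)⁻¹ * pairSwap n) := by
      rwa [inv_mul_cancel_right]
    obtain ⟨σ, hσ⟩ := exists_extendDomain_shift_eq
      ((isDumontDerangement_mul_pairSwap_iff _).1 hτ')
    refine ⟨σ, (isDPermutation_iff_extendDomain σ).2 ?_, ?_⟩
    · rw [hσ]
      exact (isDumontDerangement_mul_pairSwap_iff _).1 hτ'
    · simp only [hσ, inv_mul_cancel_right]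

end DPerm

theorem theorem4p1 (n : ℕ) (hn : 1 ≤ n) :
    (DPerm.dCycles (DPerm.interval (2 * n))).ncard = DPerm.genocchi n ∧
    (DPerm.dPermutations (DPerm.interval (2 * n))).ncard =
      DPerm.medianGenocchi n :=
  ⟨DPerm.ncard_dCycles n hn, DPerm.ncard_dPermutations n⟩
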